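/- A co-Heyting algebra is a bounded distributive lattice $L$ in which $a-b=\min\{c\in L : a\le b\vee c\}$ exists for all $a,b\in L$. Let $\operatorname{Spec} L$ be the set of (proper) prime filters of $L$, ordered by inclusion. The height of $\mathfrak p\in\operatorname{Spec}L$ is the supremum in $\mathbb N\cup\{+\infty\}$ of the integers $k$ for which there is a chain $\mathfrak p_0\subsetneq\cdots\subsetneq\mathfrak p_k=\mathfrak p$ in $\operatorname{Spec} L$, and the codimension of $a\in L$ is $\operatorname{codim}_L a=\min\{\operatorname{height}\mathfrak p : \mathfrak p\in\operatorname{Spec}L,\ a\in\mathfrak p\}$, with $\min\emptyset=+\infty$. For a positive integer $d$ let $dL=\{a\in L : \operatorname{codim}_L a\ge d\}$, which is an ideal of $L$. Proposition. For all positive integers $n,d$ there exists a term $t_{n,d}$ in $n$ variables in the language $\{\mathbf 0,\mathbf 1,\vee,\wedge,-\}$ of co-Heyting algebras such that, for every co-Heyting algebra $L$ and every $n$-tuple $a\in L^n$ that generates $L$ as a co-Heyting algebra, $t_{n,d}(a)$ is the generator $\varepsilon_d(L)$ of $dL$; that is, $dL=\{x\in L : x\le t_{n,d}(a)\}$, so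 that $t_{n,d}(a)$ is the greatest element of $L$ of codimension $\ge d$. -/

import Mathlib

universe u

/-- Terms in `n` variables of the language `{0, 1, ∨, ∧, -}` of co-Heyting algebras. -/
inductive CoHeytingTerm (n : ℕ) : Type
  | var (i : Fin n) : CoHeytingTerm n
  | zero : CoHeytingTerm n
  | one : CoHeytingTerm n
  | join (s t : CoHeytingTerm n) : CoHeytingTerm n
  | meet (s t : CoHeytingTerm n) : CoHeytingTerm n
  | sub (s t : CoHeytingTerm n) : CoHeytingTerm n

/-- The value `t(a)` of a term at an `n`-tuple of elements of a co-Heyting algebra. The co-Heyting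
difference `a - b = min {c | a ≤ b ∨ c}` is Mathlib's `a \ b`. -/
def CoHeytingTerm.eval {n : ℕ} {L : Type u} [CoheytingAlgebra L] (a : Fin n → L) :
    CoHeytingTerm n → L
  | .var i => a i
  | .zero => ⊥
  | .one => ⊤
  | .join s t => s.eval a ⊔ t.eval a
  | .meet s t => s.eval a ⊓ t.eval a
  | .sub s t => s.eval a \ t.eval a

/-- `S` is (the underlying set of) a co-Heyting subalgebra of `L`. -/
structure IsCoHeytingSubalgebra {L : Type u} [CoheytingAlgebra L] (S : Set L) : Prop where
  bot_mem : ⊥ ∈ S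
  top_mem : ⊤ ∈ S
  sup_mem : ∀ x ∈ S, ∀ y ∈ S, x ⊔ y ∈ S
  inf_mem : ∀ x ∈ S, ∀ y ∈ S, x ⊓ y ∈ S
  sdiff_mem : ∀ x ∈ S, ∀ y ∈ S, x \ y ∈ S

/-- `L` is generated by the tuple `a`: the only co-Heyting subalgebra of `L` that contains all
entries of `a` is `L` itself. -/
def IsGeneratedBy (L : Type u) [CoheytingAlgebra L] {n : ℕ} (a : Fin n → L) : Prop :=
  ∀ S : Set L, IsCoHeytingSubalgebra S → (∀ i, a i ∈ S) → S = Set.univ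

/-- The prime filter spectrum of `L`, ordered by inclusion. (Mathlib's `IsPrime` asks that the
complement be an ideal, in particular nonempty, so that prime filters are proper.) -/
abbrev PrimeFilterSpec (L : Type u) [CoheytingAlgebra L] : Type u :=
  {p : Order.PFilter L // p.IsPrime}

/-- The codimension of `a`: the minimum, over the prime filters `p` containing `a`, of the height of
`p` in the spectrum, and `⊤` (that is `+∞`) when there is no such `p`. Heights are taken in `ℕ∞`,
all infinite foundation ranks being identified with `⊤`; this does not affect the relation
`d ≤ codim a` for natural numbers `d`. -/
noncomputable def codim {L : Type u} [CoheytingAlgebra L] (a : L) : ℕ∞ :=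
  ⨅ (p : PrimeFilterSpec L) (_ : a ∈ p.1), Order.height p

theorem le_codim_iff {L : Type u} [CoheytingAlgebra L] {a : L} {d : ℕ∞} :
    d ≤ codim a ↔ ∀ p : PrimeFilterSpec L, a ∈ p.1 → d ≤ Order.height p := by
  simp only [codim, le_iInf_iff]

theorem PrimeFilterSpec.mem_or_mem {L : Type u} [CoheytingAlgebra L] (p : PrimeFilterSpec L)
    {a b : L} (h : a ⊔ b ∈ p.1) : a ∈ p.1 ∨ b ∈ p.1 := by
  by_contra! hab
  exact (Order.Ideal.sup_mem (s := p.2.compl_ideal.toIdeal) hab.1 hab.2) h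

theorem PrimeFilterSpec.bot_notMem {L : Type u} [CoheytingAlgebra L] (p : PrimeFilterSpec L) :
    (⊥ : L) ∉ p.1 :=
  Order.Ideal.bot_mem p.2.compl_ideal.toIdeal

/-- The ideal `dL` of all elements of `L` of codimension at least `d`. -/
def codimIdeal (L : Type u) [CoheytingAlgebra L] (d : ℕ) : Order.Ideal L where
  carrier := {a | (d : ℕ∞) ≤ codim a}
  lower' := fun _ _ hba ha =>
    le_codim_iff.2 fun p hp => le_codim_iff.1 ha p (Order.PFilter.mem_of_le hba hp)
  nonempty' := ⟨⊥, le_codim_iff.2 fun p hp => absurd hp p.bot_notMem⟩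
  directed' := fun a ha b hb => ⟨a ⊔ b,
    le_codim_iff.2 fun p hp =>
      (p.mem_or_mem hp).elim (le_codim_iff.1 ha p) (le_codim_iff.1 hb p),
    le_sup_left, le_sup_right⟩

/-! Membership of term values in a prime filter behaves like forcing in a Kripke model, with `-`
looking down the spectrum. Hence only finitely many theories occur at primes of height `< d`,
uniformly in `L` (`theory_mem_theories`), and a map `r` with finite range sends each term to one
with which it agrees there. The required term joins the depth terms over `range r` with the
symmetric differences of `s` and `r s`, for `s` one step above `range r`. A prime containing its
value has height `≥ d`: a depth term yields a chain, and a symmetric difference yields a smaller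
prime outside the reach of `r`. If a prime `p` omits the value, `range r` is closed under the
operations up to agreement below `p`, so by generation it represents all of `L` there. A chain of
length `d` ending at `p` would then put a depth term in `p`. -/

namespace PrimeFilterSpec

variable {L : Type u} [CoheytingAlgebra L]

/-- Prime separation: a filter and an ideal that are disjoint are separated by a prime filter. -/
theorem exists_of_disjoint {F : Order.PFilter L} {I : Order.Ideal L}
    (h : Disjoint (F : Set L) (I : Set L)) :
    ∃ q : PrimeFilterSpec L, (∀ x ∈ F, x ∈ q.1) ∧ ∀ x ∈ I, x ∉ q.1 := by
  obtain ⟨J, hJ, hIJ, hFJ⟩ := DistribLattice.prime_ideal_of_disjoint_filter_ideal h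
  have hmem : ∀ x, x ∈ hJ.toPrimePair.F ↔ x ∉ J := fun x => by
    rw [← SetLike.mem_coe, ← hJ.toPrimePair.compl_I_eq_F]
    rfl
  exact ⟨⟨hJ.toPrimePair.F, hJ.toPrimePair.F_isPrime⟩,
    fun x hx => (hmem x).2 (Set.disjoint_left.1 hFJ hx),
    fun x hx hxq => (hmem x).1 hxq (hIJ hx)⟩

theorem le_iff_forall_mem {a b : L} : a ≤ b ↔ ∀ p : PrimeFilterSpec L, a ∈ p.1 → b ∈ p.1 := by
  refine ⟨fun h p => Order.PFilter.mem_of_le h, fun h => ?_⟩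
  by_contra hab
  have hdisj : Disjoint (Order.PFilter.principal a : Set L) (Order.Ideal.principal b : Set L) :=
    Set.disjoint_left.2 fun x hx hx' => hab (le_trans hx hx')
  obtain ⟨q, hq, hq'⟩ := exists_of_disjoint hdisj
  exact hq' b le_rfl (h q (hq a le_rfl))

theorem sup_mem_iff (p : PrimeFilterSpec L) {a b : L} : a ⊔ b ∈ p.1 ↔ a ∈ p.1 ∨ b ∈ p.1 :=
  ⟨p.mem_or_mem, fun h => h.elim (Order.PFilter.mem_of_le le_sup_left)
    (Order.PFilter.mem_of_le le_sup_right)⟩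

/-- The prime `q` separates `a` from the ideal generated by `b` and the complement of `p`: if `a ≤ j
⊔ b` then `a \ b ≤ j`, which excludes `j ∉ p`. -/
theorem sdiff_mem_iff (p : PrimeFilterSpec L) {a b : L} :
    a \ b ∈ p.1 ↔ ∃ q ≤ p, a ∈ q.1 ∧ b ∉ q.1 := by
  constructor
  · intro h
    have hdisj : Disjoint (Order.PFilter.principal a : Set L)
        ((p.2.compl_ideal.toIdeal ⊔ Order.Ideal.principal b : Order.Ideal L) : Set L) := by
      refine Set.disjoint_left.2 fun x hx hx' => ?_
      obtain ⟨j, hj, hxj⟩ := (Lattice.mem_ideal_sup_principal b x _).1 hx'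
      exact hj (Order.PFilter.mem_of_le (sdiff_le_iff.2 ((le_trans hx hxj).trans_eq (sup_comm _ _))) h)
    obtain ⟨q, hq, hq'⟩ := exists_of_disjoint hdisj
    refine ⟨q, fun x hx => ?_, hq a le_rfl, hq' b ?_⟩
    · by_contra hxp
      exact hq' x ((le_sup_left : p.2.compl_ideal.toIdeal ≤ _) hxp) hx
    · exact (le_sup_right : Order.Ideal.principal b ≤ _) (le_refl b)
  · rintro ⟨q, hqp, ha, hb⟩
    have h : b ⊔ a \ b ∈ q.1 := Order.PFilter.mem_of_le le_sup_sdiff ha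
    exact hqp ((q.mem_or_mem h).resolve_left hb)

theorem sdiff_mem_iff_or (p : PrimeFilterSpec L) {a b : L} :
    a \ b ∈ p.1 ↔ (a ∈ p.1 ∧ b ∉ p.1) ∨ ∃ q < p, a ∈ q.1 ∧ b ∉ q.1 := by
  rw [sdiff_mem_iff]
  constructor
  · rintro ⟨q, hqp, h⟩
    rcases hqp.eq_or_lt with rfl | hlt
    · exact .inl h
    · exact .inr ⟨q, hlt, h⟩
  · rintro (h | ⟨q, hlt, h⟩)
    · exact ⟨p, le_rfl, h⟩
    · exact ⟨q, hlt.le, h⟩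

theorem add_one_le_height_iff (p : PrimeFilterSpec L) (k : ℕ) :
    ((k + 1 : ℕ) : ℕ∞) ≤ Order.height p ↔ ∃ q < p, (k : ℕ∞) ≤ Order.height q := by
  rw [Nat.cast_add, Nat.cast_one, ENat.add_one_le_iff (ENat.natCast_ne_top k), ← not_le,
    Order.height_le_coe_iff]
  push Not
  rfl

end PrimeFilterSpec

namespace CoHeytingTerm

variable {n : ℕ} {L : Type u} [CoheytingAlgebra L]

/-- The truth value of a term at a node of a finite-depth Kripke model: `c` is the set of variables
true at the node and `X` is the set of theories of the nodes strictly below it. -/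
def Forces (c : Set (Fin n)) (X : Set (Set (CoHeytingTerm n))) : CoHeytingTerm n → Prop
  | .var i => i ∈ c
  | .zero => False
  | .one => True
  | .join s t => Forces c X s ∨ Forces c X t
  | .meet s t => Forces c X s ∧ Forces c X t
  | .sub s t => (Forces c X s ∧ ¬ Forces c X t) ∨ ∃ Y ∈ X, s ∈ Y ∧ t ∉ Y

/-- The theories of the nodes of height `< k` in Kripke models. -/
def theories (n : ℕ) : ℕ → Set (Set (CoHeytingTerm n))
  | 0 => ∅
  | k + 1 => (fun w : Set (Fin n) × Set (Set (CoHeytingTerm n)) => {t | Forces w.1 w.2 t}) ''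
      (Set.univ ×ˢ (theories n k).powerset)

theorem finite_theories (n k : ℕ) : (theories n k).Finite := by
  induction k with
  | zero => exact Set.finite_empty
  | succ k ih => exact (Set.finite_univ.prod ih.finite_subsets).image _

/-- The theory of `p` depends only on the variables true at `p` and on the theories of the primes
strictly below it, which have smaller height. -/
theorem theory_mem_theories (a : Fin n → L) (k : ℕ) (p : PrimeFilterSpec L)
    (hp : Order.height p < k) : {t : CoHeytingTerm n | t.eval a ∈ p.1} ∈ theories n k := by
  induction k generalizing p with
  | zero => simp at hp
  | succ k ih =>
    refine ⟨({i | a i ∈ p.1}, (fun q : PrimeFilterSpec L => {t | t.eval a ∈ q.1}) '' Set.Iio p),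
      ⟨trivial, ?_⟩, ?_⟩
    · rintro _ ⟨q, hq, rfl⟩
      refine ih q (lt_of_not_ge fun hk => ?_)
      exact hp.not_ge ((p.add_one_le_height_iff k).2 ⟨q, hq, hk⟩)
    · ext t
      simp only [Set.mem_ofPred_eq]
      induction t with
      | var i => rfl
      | zero => exact ⟨False.elim, fun h => p.bot_notMem h⟩
      | one => exact ⟨fun _ => Order.PFilter.top_mem, fun _ => trivial⟩
      | join s t hs ht => simp only [Forces, eval, p.sup_mem_iff, hs, ht]
      | meet s t hs ht => simp only [Forces, eval, Order.PFilter.inf_mem_iff, hs, ht]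
      | sub s t hs ht =>
        simp only [Forces, eval, p.sdiff_mem_iff_or, hs, ht, Set.exists_mem_image,
          Set.mem_ofPred_eq, Set.mem_Iio]

/-- Up to agreement on finitely many theories there are finitely many terms. -/
theorem exists_representatives (A : Set (Set (CoHeytingTerm n))) (hA : A.Finite) :
    ∃ r : CoHeytingTerm n → CoHeytingTerm n, (Set.range r).Finite ∧
      ∀ t, ∀ Y ∈ A, r t ∈ Y ↔ t ∈ Y := by
  let φ : CoHeytingTerm n → Set (Set (CoHeytingTerm n)) := fun t => {Y ∈ A | t ∈ Y}
  have : Nonempty (CoHeytingTerm n) := ⟨.zero⟩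
  refine ⟨fun t => Function.invFun φ (φ t), ?_, fun t Y hY => ?_⟩
  · refine (hA.finite_subsets.image (Function.invFun φ)).subset ?_
    rintro _ ⟨t, rfl⟩
    exact ⟨φ t, Set.sep_subset _ _, rfl⟩
  · have h : φ (Function.invFun φ (φ t)) = φ t := Function.invFun_eq ⟨t, rfl⟩
    simpa [φ, hY] using Set.ext_iff.1 h Y

theorem exists_finite_join {A : Set (CoHeytingTerm n)} (hA : A.Finite) :
    ∃ t : CoHeytingTerm n, ∀ (L : Type u) [CoheytingAlgebra L] (a : Fin n → L)
      (p : PrimeFilterSpec L), t.eval a ∈ p.1 ↔ ∃ s ∈ A, s.eval a ∈ p.1 := by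
  induction A, hA using Set.Finite.induction_on with
  | empty => exact ⟨.zero, fun L _ a p => by simpa [eval] using p.bot_notMem⟩
  | @insert s A _ _ ih =>
    obtain ⟨t, ht⟩ := ih
    exact ⟨.join s t, fun L _ a p => by simp [eval, p.sup_mem_iff, ht]⟩

/-- The symmetric difference of two terms. -/
def symmDiff (s t : CoHeytingTerm n) : CoHeytingTerm n :=
  .join (.sub s t) (.sub t s)

theorem eval_symmDiff_mem_iff (a : Fin n → L) (p : PrimeFilterSpec L) (s t : CoHeytingTerm n) :
    (symmDiff s t).eval a ∈ p.1 ↔ ∃ q ≤ p, ¬ (s.eval a ∈ q.1 ↔ t.eval a ∈ q.1) := by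
  simp only [symmDiff, eval, p.sup_mem_iff, p.sdiff_mem_iff, ← exists_or, ← and_or_left]
  refine exists_congr fun q => and_congr_right fun _ => ?_
  tauto

/-- The dual bounded depth terms `x_k ∧ (⋯ (x_1 ∧ (1 - x_1)) ⋯ - x_k)` with all `x_i` in `S`. -/
def depthTerms (S : Set (CoHeytingTerm n)) : ℕ → Set (CoHeytingTerm n)
  | 0 => {.one}
  | k + 1 => Set.image2 (fun s t => .meet s (.sub t s)) S (depthTerms S k)

theorem finite_depthTerms {S : Set (CoHeytingTerm n)} (hS : S.Finite) (k : ℕ) :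
    (depthTerms S k).Finite := by
  induction k with
  | zero => exact Set.finite_singleton _
  | succ k ih => exact hS.image2 _ ih

theorem le_height_of_depthTerm_mem (a : Fin n → L) {S : Set (CoHeytingTerm n)} {k : ℕ}
    {t : CoHeytingTerm n} (ht : t ∈ depthTerms S k) (p : PrimeFilterSpec L)
    (hp : t.eval a ∈ p.1) : (k : ℕ∞) ≤ Order.height p := by
  induction k generalizing t p with
  | zero => simp
  | succ k ih =>
    obtain ⟨s, -, t, ht, rfl⟩ := ht
    simp only [eval, Order.PFilter.inf_mem_iff, p.sdiff_mem_iff_or] at hp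
    obtain ⟨hs, ⟨-, hs'⟩ | ⟨q, hq, htq, -⟩⟩ := hp
    · exact absurd hs hs'
    · exact (p.add_one_le_height_iff k).2 ⟨q, hq, ih ht q htq⟩

/-- Each strict inclusion in a chain ending at `p` is witnessed by some element of `L`, which a term
of `S` can replace at all primes below `p`. -/
theorem exists_depthTerm_mem (a : Fin n → L) {S : Set (CoHeytingTerm n)} (p : PrimeFilterSpec L)
    (hS : ∀ x : L, ∃ s ∈ S, ∀ q ≤ p, (x ∈ q.1 ↔ s.eval a ∈ q.1)) {k : ℕ}
    (hk : (k : ℕ∞) ≤ Order.height p) : ∃ t ∈ depthTerms S k, t.eval a ∈ p.1 := by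
  induction k generalizing p with
  | zero => exact ⟨.one, rfl, Order.PFilter.top_mem⟩
  | succ k ih =>
    obtain ⟨q, hq, hkq⟩ := (p.add_one_le_height_iff k).1 hk
    obtain ⟨t, ht, htq⟩ := ih q (fun x => (hS x).imp fun s hs =>
      ⟨hs.1, fun q' hq' => hs.2 q' (hq'.trans hq.le)⟩) hkq
    obtain ⟨x, hxp, hxq⟩ := Set.exists_of_ssubset (show (q.1 : Set L) ⊂ p.1 from hq)
    obtain ⟨s, hs, hxs⟩ := hS x
    refine ⟨_, Set.mem_image2_of_mem hs ht, ?_⟩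
    simp only [eval, Order.PFilter.inf_mem_iff, p.sdiff_mem_iff]
    exact ⟨(hxs p le_rfl).1 hxp, q, hq.le, htq, fun h => hxq ((hxs q hq.le).2 h)⟩

/-- The terms obtained from `S` by applying one symbol of the language or taking a variable. -/
def oneStep (S : Set (CoHeytingTerm n)) : Set (CoHeytingTerm n) :=
  Set.range .var ∪ {.zero, .one} ∪
    (Set.image2 .join S S ∪ Set.image2 .meet S S ∪ Set.image2 .sub S S)

theorem finite_oneStep {S : Set (CoHeytingTerm n)} (hS : S.Finite) : (oneStep S).Finite :=
  ((Set.finite_range _).union (Set.toFinite _)).union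
    (((hS.image2 _ hS).union (hS.image2 _ hS)).union (hS.image2 _ hS))

/-- If below `p` every term one step above `S` agrees with a member of `S`, then so does every
element of a generated algebra. -/
theorem exists_representative_of_oneStep {a : Fin n → L} (ha : IsGeneratedBy L a)
    {S : Set (CoHeytingTerm n)} (p : PrimeFilterSpec L)
    (hS : ∀ t ∈ oneStep S, ∃ s ∈ S, ∀ q ≤ p, (t.eval a ∈ q.1 ↔ s.eval a ∈ q.1)) (x : L) :
    ∃ s ∈ S, ∀ q ≤ p, (x ∈ q.1 ↔ s.eval a ∈ q.1) := by
  have key := ha {x | ∃ s ∈ S, ∀ q ≤ p, (x ∈ q.1 ↔ s.eval a ∈ q.1)}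
  refine (Set.eq_univ_iff_forall.1 (key ⟨?_, ?_, ?_, ?_, ?_⟩ fun i => ?_)) x
  · exact hS .zero (by simp [oneStep])
  · exact hS .one (by simp [oneStep])
  · rintro x ⟨s, hs, hxs⟩ y ⟨t, ht, hyt⟩
    obtain ⟨w, hw, h⟩ := hS (.join s t) (.inr (.inl (.inl (Set.mem_image2_of_mem hs ht))))
    refine ⟨w, hw, fun q hq => ?_⟩
    rw [← h q hq, eval, q.sup_mem_iff, q.sup_mem_iff, hxs q hq, hyt q hq]
  · rintro x ⟨s, hs, hxs⟩ y ⟨t, ht, hyt⟩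
    obtain ⟨w, hw, h⟩ := hS (.meet s t) (.inr (.inl (.inr (Set.mem_image2_of_mem hs ht))))
    refine ⟨w, hw, fun q hq => ?_⟩
    rw [← h q hq, eval, Order.PFilter.inf_mem_iff, Order.PFilter.inf_mem_iff, hxs q hq, hyt q hq]
  · rintro x ⟨s, hs, hxs⟩ y ⟨t, ht, hyt⟩
    obtain ⟨w, hw, h⟩ := hS (.sub s t) (.inr (.inr (Set.mem_image2_of_mem hs ht)))
    refine ⟨w, hw, fun q hq => ?_⟩
    rw [← h q hq, eval, q.sdiff_mem_iff, q.sdiff_mem_iff]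
    refine exists_congr fun q' => and_congr_right fun hq' => ?_
    rw [hxs q' (hq'.trans hq), hyt q' (hq'.trans hq)]
  · exact hS (.var i) (by simp [oneStep])

end CoHeytingTerm

open CoHeytingTerm

theorem mainTheorem10 (n d : ℕ) (hn : 0 < n) (hd : 0 < d) :
    ∃ t : CoHeytingTerm n,
      ∀ (L : Type u) [CoheytingAlgebra L] (a : Fin n → L), IsGeneratedBy L a →
        codimIdeal L d = Order.Ideal.principal (t.eval a) ∧
          IsGreatest {x : L | (d : ℕ∞) ≤ codim x} (t.eval a) := by
  obtain ⟨r, hr, hrA⟩ := exists_representatives (theories n d) (finite_theories n d)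
  obtain ⟨t, ht⟩ := exists_finite_join ((finite_depthTerms hr d).union
    ((finite_oneStep hr).image fun s => symmDiff s (r s)))
  refine ⟨t, fun L _ a ha => ?_⟩
  have hgreatest : IsGreatest {x : L | (d : ℕ∞) ≤ codim x} (t.eval a) := by
    constructor
    · refine le_codim_iff.2 fun p hp => ?_
      obtain ⟨s, hs | ⟨s, -, rfl⟩, hsp⟩ := (ht L a p).1 hp
      · exact le_height_of_depthTerm_mem a hs p hsp
      · obtain ⟨q, hq, hne⟩ := (eval_symmDiff_mem_iff a p s (r s)).1 hsp
        by_contra hlt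
        have hqd : Order.height q < d := (Order.height_mono hq).trans_lt (not_le.1 hlt)
        -- As `q` has height `< d`, its theory is among those on which `s` and `r s` agree.
        exact hne (hrA s _ (theory_mem_theories a d q hqd)).symm
    · refine fun c hc => PrimeFilterSpec.le_iff_forall_mem.2 fun p hcp => ?_
      by_contra htp
      have hS : ∀ s ∈ oneStep (Set.range r), ∃ s' ∈ Set.range r,
          ∀ q ≤ p, (s.eval a ∈ q.1 ↔ s'.eval a ∈ q.1) := by
        refine fun s hs => ⟨r s, ⟨s, rfl⟩, fun q hq => ?_⟩
        by_contra hne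
        exact htp ((ht L a p).2 ⟨_, .inr ⟨s, hs, rfl⟩, (eval_symmDiff_mem_iff a p s (r s)).2
          ⟨q, hq, hne⟩⟩)
      obtain ⟨s, hs, hsp⟩ := exists_depthTerm_mem a p (exists_representative_of_oneStep ha p hS)
        (le_codim_iff.1 hc p hcp)
      exact htp ((ht L a p).2 ⟨s, .inl hs, hsp⟩)
  refine ⟨?_, hgreatest⟩
  ext x
  exact ⟨fun hx => hgreatest.2 hx, fun hx => (codimIdeal L d).lower hx hgreatest.1⟩
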